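/- Let $q>1$ be real and $M\in\mathbb Z$. For $0<|b|<1$ put $(a;b)_n=\prod_{i=0}^{n-1}(1-ab^i)$, $(a;b)_\infty=\prod_{i\ge 0}(1-ab^i)$ and $(a_1,a_2;b)_\infty=(a_1;b)_\infty(a_2;b)_\infty$, and let $$\sin_q(z)=\sum_{n\ge0}(-1)^nq^{-2n(n+1)}\frac{z^{2n+1}}{(q^{-2};q^{-2})_{2n+1}},\quad \cos_q(z)=\sum_{n\ge0}(-1)^nq^{-2n(n+1)}\frac{z^{2n}}{(q^{-2};q^{-2})_{2n}},\quad N_q=\frac{(q^{-2};q^{-4})_\infty}{(q^{-4};q^{-4})_\infty}.$$ Let ${}_1\Phi_1(a;c;b,z)=\sum_{n\ge0}\frac{(a;b)_n}{(c;b)_n(b;b)_n}(-1)^nb^{n(n-1)/2}z^n$ and ${}_2\Phi_1(a_1,a_2;c;b,z)=\sum_{n\ge0}\frac{(a_1;b)_n(a_2;b)_n}{(c;b)_n(b;b)_n}z^n$, and, for $z>0$, with $b=q^{-4}$, let $J_\nu(z)=z^\nu\frac{(b^{\nu+1};b)_\infty}{(b;b)_\infty}\,{}_1\Phi_1(0;b^{\nu+1};b,bz^2)$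 be the Hahn–Exton $q$-Bessel function. Put $\nabla f(x)=\frac{f(qx)-f(q^{-1}x)}{(q-q^{-1})x}$ for $x\ne0$ and $\int_{-\infty}^{2M}h=(q-q^{-1})\sum_{\mu=-\infty}^{M}q^{2\mu-1}h(q^{2\mu-1})$. The $q$-cosine transform of a function $f$ on the lattice $\{q^{2n}:n\in\mathbb Z\}$ is the function $q^{2k}\mapsto N_q\sum_{n\in\mathbb Z}q^{2n}\cos_q(q^{2(k+n)})f(q^{2n})$ on the same lattice; the inverse transform is given by the same formula. Let $\Theta(q^{2n}-q^{2M})=1$ if $n\le M$ and $0$ if $n>M$. (1) For every $k\in\mathbb Z$ the series defining the $q$-cosine transform $\widetilde\Theta(q^{2k}-q^{2M})$ of $q^{2n}\mapsto\Theta(q^{2n}-q^{2M})$ converges absolutely, and $$\widetilde\Theta(q^{2k}-q^{2M})=N_q\sum_{n=-\infty}^{M}q^{2n}\cos_q(q^{2(k+n)})=N_qq^{-2k}\int_{-\infty}^{2M}\nabla_x\sin_q(xq^{2k})=N_qq^{-2k}\sin_q(q^{2(k+M)}),$$ where moreover $\int_{-\infty}^{2M}\nabla_x\sin_q(xq^{2k})=\sin_q(q^{2(k+M)})$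 (Stokes' theorem). (2) Let $g(q^{2n})=N_q\sum_{k\in\mathbb Z}q^{2k}\cos_q(q^{2(k+n)})\widetilde\Theta(q^{2k}-q^{2M})$ be the inverse transform. For every $n\in\mathbb Z$ this series and the series of Bessel functions below converge absolutely, and $$g(q^{2n})=N_q^2\sum_{k\in\mathbb Z}\cos_q(q^{2(k+n)})\sin_q(q^{2(k+M)})=q^{M+n}\sum_{k\in\mathbb Z}q^{-2k}J_{-1/2}(q^{2(n-k)})J_{1/2}(q^{2(M-k)}).$$ Moreover, with absolutely convergent hypergeometric series, $$g(q^{2n})=q^{M+n}\,q^{M-3n}\frac{(1,q^{-6};q^{-4})_\infty}{(q^{-2},q^{-4};q^{-4})_\infty}\,{}_2\Phi_1(q^{-4},q^{-2};q^{-6};q^{-4},q^{-4(n-M)})\quad\text{if } n>M,$$ $$g(q^{2n})=q^{M+n}\,q^{-(M+n)}\frac{(q^{-4},q^{-2};q^{-4})_\infty}{(q^{-2},q^{-4};q^{-4})_\infty}\,{}_2\Phi_1(1,q^{-2};q^{-2};q^{-4},q^{-4(M-n+1)})\quad\text{if } n\le M.$$ Here $(1;q^{-4})_\infty=0$, and $g(q^{2n})=0$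 for $n>M$ while $g(q^{2n})=1$ for $n\le M$; that is, $g(q^{2n})=\Theta(q^{2n}-q^{2M})$ for all $n\in\mathbb Z$. -/

import Mathlib

noncomputable section

/-- The finite `q`-shifted factorial `(a; b)_n = ∏_{i < n} (1 - a b^i)`. -/
def qPoch (a b : ℝ) (n : ℕ) : ℝ := ∏ i ∈ Finset.range n, (1 - a * b ^ i)

/-- The infinite `q`-shifted factorial `(a; b)_∞ = ∏_{i ≥ 0} (1 - a b^i)`, for `|b| < 1`. -/
def qPochInf (a b : ℝ) : ℝ := ∏' i : ℕ, (1 - a * b ^ i)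

/-- `sin_q(z) = ∑ (-1)^n q^{-2n(n+1)} z^{2n+1} / (q^{-2}; q^{-2})_{2n+1}`. -/
def sinQ (q z : ℝ) : ℝ :=
  ∑' n : ℕ, (-1) ^ n * q ^ (-(2 * (n : ℤ) * ((n : ℤ) + 1))) * z ^ (2 * n + 1) /
    qPoch (q ^ (-2 : ℤ)) (q ^ (-2 : ℤ)) (2 * n + 1)

/-- `cos_q(z) = ∑ (-1)^n q^{-2n(n+1)} z^{2n} / (q^{-2}; q^{-2})_{2n}`. -/
def cosQ (q z : ℝ) : ℝ :=
  ∑' n : ℕ, (-1) ^ n * q ^ (-(2 * (n : ℤ) * ((n : ℤ) + 1))) * z ^ (2 * n) /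
    qPoch (q ^ (-2 : ℤ)) (q ^ (-2 : ℤ)) (2 * n)

/-- The normalization constant `N_q = (q^{-2}; q^{-4})_∞ / (q^{-4}; q^{-4})_∞`. -/
def normQ (q : ℝ) : ℝ :=
  qPochInf (q ^ (-2 : ℤ)) (q ^ (-4 : ℤ)) / qPochInf (q ^ (-4 : ℤ)) (q ^ (-4 : ℤ))

/-- The lattice step function: the value `Θ(q^{2n} - q^{2M})` at the lattice point `q^{2n}`. -/
def latticeStep (M n : ℤ) : ℝ := if n ≤ M then 1 else 0

/-- The `q`-cosine transform of a function on the even lattice `{q^{2n} : n ∈ ℤ}`, where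
`f n` stands for the value at `q^{2n}`. The result is again indexed by the exponent, and the inverse
transform is given by the same formula. -/
def qCosTransform (q : ℝ) (f : ℤ → ℝ) (k : ℤ) : ℝ :=
  normQ q * ∑' n : ℤ, q ^ (2 * n) * cosQ q (q ^ (2 * (k + n))) * f n

/-- The symmetric `q`-derivative `∇ f(x) = (f(qx) - f(q⁻¹x)) / ((q - q⁻¹) x)`, for `x ≠ 0`. -/
def qDeriv (q : ℝ) (f : ℝ → ℝ) (x : ℝ) : ℝ :=
  (f (q * x) - f (q⁻¹ * x)) / ((q - q⁻¹) * x)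

/-- The `q`-integral `∫_{-∞}^{2M} h = (q - q⁻¹) ∑_{μ ≤ M} q^{2μ-1} h(q^{2μ-1})`, that is, the Jackson
type integral from `0` to `q^{2M}`. -/
def qIntegral (q : ℝ) (h : ℝ → ℝ) (M : ℤ) : ℝ :=
  (q - q⁻¹) * ∑' μ : Set.Iic M, q ^ (2 * (μ : ℤ) - 1) * h (q ^ (2 * (μ : ℤ) - 1))

/-- The basic hypergeometric series `₁Φ₁(a; c; b, z)` of base `b`. -/
def phi11 (a c b z : ℝ) : ℝ :=
  ∑' n : ℕ, qPoch a b n / (qPoch c b n * qPoch b b n) * ((-1) ^ n * b ^ (n.choose 2)) * z ^ n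

/-- The `n`-th term of the basic hypergeometric series `₂Φ₁(a₁, a₂; c; b, z)` of base `b`. -/
def phi21Term (a₁ a₂ c b z : ℝ) (n : ℕ) : ℝ :=
  qPoch a₁ b n * qPoch a₂ b n / (qPoch c b n * qPoch b b n) * z ^ n

/-- The basic hypergeometric series `₂Φ₁(a₁, a₂; c; b, z)` of base `b`. -/
def phi21 (a₁ a₂ c b z : ℝ) : ℝ := ∑' n : ℕ, phi21Term a₁ a₂ c b z n

/-- The Hahn–Exton (Jackson third) `q`-Bessel function of base `b`, for `z > 0`:
`J_ν(z; b) = z^ν (b^{ν+1}; b)_∞ / (b; b)_∞ · ₁Φ₁(0; b^{ν+1}; b, b z²)`. -/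
def besselJ (b ν z : ℝ) : ℝ :=
  z ^ ν * (qPochInf (b ^ (ν + 1)) b / qPochInf b b) * phi11 0 (b ^ (ν + 1)) b (b * z ^ 2)

end

/-!
The point is that the lattice sequences `c k = cos_q(q^{2k})` and `s k = sin_q(q^{2k})` satisfy the
first-order system `s k - s (k-1) = q^{2k} c k`, `c (k+1) - c k = -q^{2k} s k`, and that they are
small at `+∞`, although their power series in `q^{2k}` do not show it.

Decay and total mass. Up to elementary factors both functions are Hahn–Exton functions
`(z; b)_∞ ₁Φ₁(0; z; b, w)` of base `b = q^{-4}`. Expanding `(z b^n; b)_∞` by Euler's identity gives a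
double series that is symmetric in `w` and `z` (`hahnExton_comm`). After the exchange the lattice
variable sits in `(b^{1-k+n}; b)_∞`, which vanishes for `n < k`; this gives absolute convergence over
`k ∈ ℤ` with any geometric weight, and the sum over `k` factors into two Euler products
(`hasSum_zpow_mul_hahnExton`). A special case is `∑ s k = N_q^{-2}` (`hasSum_sinQ_lattice`).

The transform of the step function is then a telescoping sum, `N_q q^{-2k} s (k + M)`, and its inverse
transform is `N_q² a(n - M)` with `a d = ∑ c (k + d) s k`.

Evaluation of `a` (`tsum_shift_mul_eq_ite`). Summation by parts in the sine and in the cosine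
expresses `a d - a (d+1)` through `∑ q^{2k} c k c (k+d)` and through `∑ q^{2k} s k s (k+d)`. Shifting
the index relates `d` to `-d` in both, with different powers of `q`, so that `a d = a (d+1)` unless
`d = 0`. By dominated convergence `a` tends to `0` at `+∞` and to `∑ s k` at `-∞`, since `c` tends to
`0` and to `1` there. Hence `a d` is `N_q^{-2}` for `d ≤ 0` and `0` for `d > 0`.

The Bessel form is a termwise rewriting (`besselJ_neg_half`, `besselJ_half`). In the hypergeometric
forms the factor `(1; b)_∞` vanishes if `n > M`, and the numerator parameter `1` leaves only the
constant term of the series if `n ≤ M`.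
-/

open Filter Topology

/-! ### Infinite shifted factorials -/

lemma qPoch_succ (a b : ℝ) (n : ℕ) : qPoch a b (n + 1) = qPoch a b n * (1 - a * b ^ n) :=
  Finset.prod_range_succ _ _

lemma multipliable_one_sub_mul_pow (a : ℝ) {b : ℝ} (hb : |b| < 1) :
    Multipliable (fun i : ℕ => 1 - a * b ^ i) := by
  have h : Summable (fun i : ℕ => ‖-(a * b ^ i)‖) := by
    simp only [norm_neg, norm_mul, norm_pow, Real.norm_eq_abs]
    exact (summable_geometric_of_lt_one (abs_nonneg b) hb).mul_left _
  simpa [sub_eq_add_neg] using multipliable_one_add_of_summable h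

lemma qPoch_mul_qPochInf (a : ℝ) {b : ℝ} (hb : |b| < 1) (n : ℕ) :
    qPoch a b n * qPochInf (a * b ^ n) b = qPochInf a b := by
  have h := multipliable_one_sub_mul_pow (a * b ^ n) hb
  have e : (fun i : ℕ => 1 - a * b ^ n * b ^ i) = fun i : ℕ => 1 - a * b ^ (i + n) := by
    funext i; rw [pow_add]; ring
  have := Multipliable.prod_mul_tprod_nat_mul' (f := fun i : ℕ => 1 - a * b ^ i) (k := n) (e ▸ h)
  rw [qPoch, qPochInf, qPochInf, e, this]

lemma tendsto_qPoch (a : ℝ) {b : ℝ} (hb : |b| < 1) :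
    Tendsto (fun n => qPoch a b n) atTop (𝓝 (qPochInf a b)) :=
  (multipliable_one_sub_mul_pow a hb).tendsto_prod_tprod_nat

lemma qPochInf_one {b : ℝ} (hb : |b| < 1) : qPochInf 1 b = 0 := by
  rw [← qPoch_mul_qPochInf 1 hb 1]; simp [qPoch]

lemma one_sub_mul_pow_pos {a b : ℝ} (hb0 : 0 < b) (hb1 : b < 1) (ha : a < 1) (n : ℕ) :
    0 < 1 - a * b ^ n := by
  have h1 : b ^ n ≤ 1 := pow_le_one₀ hb0.le hb1.le
  have h2 : 0 < b ^ n := pow_pos hb0 n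
  nlinarith

lemma qPoch_pos {a b : ℝ} (hb0 : 0 < b) (hb1 : b < 1) (ha : a < 1) (n : ℕ) : 0 < qPoch a b n :=
  Finset.prod_pos fun i _ => one_sub_mul_pow_pos hb0 hb1 ha i

/-! ### Euler's two expansions -/

/-- Continuity at the origin of a power series, along an arbitrary filter. -/
lemma tendsto_tsum_mul_pow {α : Type*} {l : Filter α} {a : ℕ → ℝ} {y : α → ℝ} {R : ℝ}
    (ha : Summable fun n => |a n| * R ^ n) (hy : Tendsto y l (𝓝 0)) (hR : ∀ᶠ x in l, |y x| ≤ R) :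
    Tendsto (fun x => ∑' n, a n * y x ^ n) l (𝓝 (a 0)) := by
  have h := tendsto_tsum_of_dominated_convergence (f := fun x n => a n * y x ^ n)
    (g := fun n => a n * 0 ^ n) ha (fun n => (hy.pow n).const_mul _) (by
      filter_upwards [hR] with x hx n
      rw [norm_mul, norm_pow, Real.norm_eq_abs, Real.norm_eq_abs]
      gcongr)
  rwa [tsum_eq_single 0 (by intro n hn; simp [hn]), pow_zero, mul_one] at h

/-- The coefficients `(-1)^n b^{n(n-1)/2} / (b; b)_n` of the power series of `x ↦ (x; b)_∞`. -/
noncomputable def eulerCoeff (b : ℝ) (n : ℕ) : ℝ := (-1) ^ n * b ^ n.choose 2 / qPoch b b n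

lemma eulerCoeff_zero (b : ℝ) : eulerCoeff b 0 = 1 := by simp [eulerCoeff, qPoch]

lemma eulerCoeff_succ {b : ℝ} (hb0 : 0 < b) (hb1 : b < 1) (n : ℕ) :
    eulerCoeff b (n + 1) * (1 - b ^ (n + 1)) = -(b ^ n * eulerCoeff b n) := by
  have h1 := (qPoch_pos hb0 hb1 hb1 n).ne'
  have h2 := (one_sub_mul_pow_pos hb0 hb1 hb1 n).ne'
  have h3 : (n + 1).choose 2 = n + n.choose 2 := by
    rw [Nat.choose_succ_succ' n 1, Nat.choose_one_right]
  rw [eulerCoeff, eulerCoeff, qPoch_succ, h3, pow_succ' b n, pow_succ, pow_add]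
  generalize b ^ n = B at *
  rw [mul_comm b B] at h2 ⊢
  field_simp

lemma summable_eulerCoeff {b : ℝ} (hb0 : 0 < b) (hb1 : b < 1) (x : ℝ) :
    Summable fun n => |eulerCoeff b n| * |x| ^ n := by
  refine summable_of_ratio_norm_eventually_le (r := 1 / 2) (by norm_num) ?_
  have ht : Tendsto (fun n : ℕ => b ^ n * |x|) atTop (𝓝 0) := by
    simpa using (tendsto_pow_atTop_nhds_zero_of_lt_one hb0.le hb1).mul_const |x|
  filter_upwards [ht.eventually_le_const (u := (1 - b) / 2) (by linarith)] with n hn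
  have h1 : 0 < 1 - b ^ (n + 1) := by
    simpa [pow_succ'] using one_sub_mul_pow_pos hb0 hb1 hb1 n
  have h2 : b ^ (n + 1) ≤ b := by
    simpa using pow_le_pow_of_le_one hb0.le hb1.le (Nat.le_add_left 1 n)
  have e : |eulerCoeff b (n + 1)| * (1 - b ^ (n + 1)) = b ^ n * |eulerCoeff b n| := by
    rw [← abs_of_pos h1, ← abs_mul, eulerCoeff_succ hb0 hb1, abs_neg, abs_mul,
      abs_of_pos (pow_pos hb0 n)]
  simp only [norm_mul, norm_pow, Real.norm_eq_abs, abs_abs]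
  have hA : 0 ≤ |eulerCoeff b n| * |x| ^ n := by positivity
  have key : |eulerCoeff b (n + 1)| * |x| ^ (n + 1) * (1 - b ^ (n + 1)) =
      (b ^ n * |x|) * (|eulerCoeff b n| * |x| ^ n) := by
    rw [mul_right_comm, e]; ring
  refine le_of_mul_le_mul_right ?_ h1
  rw [key]
  nlinarith

/-- Euler: `∑ (-1)^n b^{n(n-1)/2} x^n / (b; b)_n = (x; b)_∞`. Both sides satisfy
`f x = (1 - x) f (b x)` and equal `1` at the origin. -/
lemma hasSum_eulerCoeff {b : ℝ} (hb0 : 0 < b) (hb1 : b < 1) (x : ℝ) :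
    HasSum (fun n => eulerCoeff b n * x ^ n) (qPochInf x b) := by
  have hb : |b| < 1 := by rwa [abs_of_pos hb0]
  have hs : ∀ x, Summable fun n => eulerCoeff b n * x ^ n := fun x =>
    Summable.of_norm (by simpa [norm_mul, norm_pow] using summable_eulerCoeff hb0 hb1 x)
  have hrec : ∀ x, ∑' n, eulerCoeff b n * x ^ n =
      (1 - x) * ∑' n, eulerCoeff b n * (x * b) ^ n := by
    intro x
    have h : ∑' n, eulerCoeff b n * x ^ n - ∑' n, eulerCoeff b n * (x * b) ^ n =
        -x * ∑' n, eulerCoeff b n * (x * b) ^ n := by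
      rw [← (hs x).tsum_sub (hs (x * b)), ((hs x).sub (hs (x * b))).tsum_eq_zero_add, ← tsum_mul_left]
      simp only [pow_zero, sub_self, zero_add]
      refine tsum_congr fun n => ?_
      have := eulerCoeff_succ hb0 hb1 n
      calc _ = eulerCoeff b (n + 1) * (1 - b ^ (n + 1)) * x ^ (n + 1) := by rw [mul_pow]; ring
        _ = _ := by rw [this, mul_pow]; ring
    linarith
  have hN : ∀ N : ℕ, ∑' n, eulerCoeff b n * x ^ n =
      qPoch x b N * ∑' n, eulerCoeff b n * (x * b ^ N) ^ n := by
    intro N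
    induction N with
    | zero => simp [qPoch]
    | succ N ih =>
      rw [ih, hrec (x * b ^ N), qPoch_succ, pow_succ, mul_assoc (qPoch x b N), mul_assoc x]
  have hy : Tendsto (fun N : ℕ => x * b ^ N) atTop (𝓝 0) := by
    simpa using (tendsto_pow_atTop_nhds_zero_of_lt_one hb0.le hb1).const_mul x
  have ht := tendsto_tsum_mul_pow (summable_eulerCoeff hb0 hb1 x) hy
    (Eventually.of_forall fun N => by
    rw [abs_mul, abs_of_pos (pow_pos hb0 N)]
    exact mul_le_of_le_one_right (abs_nonneg x) (pow_le_one₀ hb0.le hb1.le))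
  rw [eulerCoeff_zero] at ht
  have h1 := (tendsto_qPoch x hb).mul ht
  rw [mul_one] at h1
  have h2 : ∑' n, eulerCoeff b n * x ^ n = qPochInf x b :=
    tendsto_nhds_unique (tendsto_const_nhds.congr hN) h1
  exact h2 ▸ (hs x).hasSum

lemma summable_inv_qPoch {b : ℝ} (hb0 : 0 < b) (hb1 : b < 1) {x : ℝ} (hx : |x| < 1) :
    Summable fun n => |(qPoch b b n)⁻¹| * |x| ^ n := by
  obtain ⟨r, hr1, hr2⟩ := exists_between hx
  refine summable_of_ratio_norm_eventually_le hr2 ?_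
  have hr0 : 0 < r := (abs_nonneg x).trans_lt hr1
  have ht : Tendsto (fun n : ℕ => (1 - b * b ^ n) * r) atTop (𝓝 r) := by
    simpa using (((tendsto_pow_atTop_nhds_zero_of_lt_one hb0.le hb1).const_mul b).const_sub
      1).mul_const r
  filter_upwards [ht.eventually_const_le hr1] with n hn
  have h1 := one_sub_mul_pow_pos hb0 hb1 hb1 n
  have h2 := qPoch_pos hb0 hb1 hb1 n
  simp only [norm_mul, norm_pow, Real.norm_eq_abs, abs_abs]
  rw [qPoch_succ, abs_of_pos (inv_pos.2 h2), abs_of_pos (inv_pos.2 (mul_pos h2 h1)), mul_inv,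
    pow_succ']
  have hA : 0 ≤ (qPoch b b n)⁻¹ * |x| ^ n := by positivity
  calc _ = (qPoch b b n)⁻¹ * |x| ^ n * (|x| / (1 - b * b ^ n)) := by field_simp
    _ ≤ (qPoch b b n)⁻¹ * |x| ^ n * r := by
      gcongr
      rw [div_le_iff₀ h1]; linarith
    _ = _ := by ring

/-- Euler: `∑ x^n / (b; b)_n = 1 / (x; b)_∞` for `|x| < 1`, stated without the division so that it
also shows that `(x; b)_∞` does not vanish. -/
lemma tsum_inv_qPoch_mul_qPochInf {b : ℝ} (hb0 : 0 < b) (hb1 : b < 1) {x : ℝ} (hx : |x| < 1) :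
    (∑' n, (qPoch b b n)⁻¹ * x ^ n) * qPochInf x b = 1 := by
  have hb : |b| < 1 := by rwa [abs_of_pos hb0]
  have hs : ∀ x : ℝ, |x| < 1 → Summable fun n => (qPoch b b n)⁻¹ * x ^ n := fun x hx =>
    Summable.of_norm (by simpa [norm_mul, norm_pow] using summable_inv_qPoch hb0 hb1 hx)
  have hle : ∀ N : ℕ, |x * b ^ N| ≤ |x| := fun N => by
    rw [abs_mul, abs_of_pos (pow_pos hb0 N)]
    exact mul_le_of_le_one_right (abs_nonneg x) (pow_le_one₀ hb0.le hb1.le)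
  have hrec : ∀ x : ℝ, |x| < 1 → |x * b| < 1 → ∑' n, (qPoch b b n)⁻¹ * (x * b) ^ n =
      (1 - x) * ∑' n, (qPoch b b n)⁻¹ * x ^ n := by
    intro x hx hxb
    have h : ∑' n, (qPoch b b n)⁻¹ * x ^ n - ∑' n, (qPoch b b n)⁻¹ * (x * b) ^ n =
        x * ∑' n, (qPoch b b n)⁻¹ * x ^ n := by
      rw [← (hs x hx).tsum_sub (hs (x * b) hxb),
        ((hs x hx).sub (hs (x * b) hxb)).tsum_eq_zero_add, ← tsum_mul_left]
      simp only [pow_zero, sub_self, zero_add]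
      refine tsum_congr fun n => ?_
      have h1 := (one_sub_mul_pow_pos hb0 hb1 hb1 n).ne'
      have h2 := (qPoch_pos hb0 hb1 hb1 n).ne'
      rw [qPoch_succ, mul_pow, pow_succ b, pow_succ x]
      generalize b ^ n = B at *
      field_simp
    linarith
  have hN : ∀ N : ℕ, ∑' n, (qPoch b b n)⁻¹ * (x * b ^ N) ^ n =
      qPoch x b N * ∑' n, (qPoch b b n)⁻¹ * x ^ n := by
    intro N
    induction N with
    | zero => simp [qPoch]
    | succ N ih =>
      have h2 : x * b ^ (N + 1) = x * b ^ N * b := by ring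
      rw [h2, hrec (x * b ^ N) ((hle N).trans_lt hx) (h2 ▸ (hle (N + 1)).trans_lt hx), ih,
        qPoch_succ]
      ring
  have hy : Tendsto (fun N : ℕ => x * b ^ N) atTop (𝓝 0) := by
    simpa using (tendsto_pow_atTop_nhds_zero_of_lt_one hb0.le hb1).const_mul x
  have ht := tendsto_tsum_mul_pow (summable_inv_qPoch hb0 hb1 hx) hy (Eventually.of_forall hle)
  simp only [hN] at ht
  have h1 := tendsto_nhds_unique ht ((tendsto_qPoch x hb).mul_const _)
  rw [mul_comm, ← h1]
  simp [qPoch]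

lemma qPochInf_ne_zero {b : ℝ} (hb0 : 0 < b) (hb1 : b < 1) {x : ℝ} (hx : |x| < 1) :
    qPochInf x b ≠ 0 := fun h => by
  simpa [h] using tsum_inv_qPoch_mul_qPochInf hb0 hb1 hx

/-! ### The Hahn–Exton function: symmetry and lattice sums -/

/-- The Hahn–Exton function `(z; b)_∞ ₁Φ₁(0; z; b, w)`, written so that it makes sense for every
`z`: the denominators `(z; b)_n` have been cancelled against `(z; b)_∞`. -/
noncomputable def hahnExton (b w z : ℝ) : ℝ :=
  ∑' n : ℕ, eulerCoeff b n * w ^ n * qPochInf (z * b ^ n) b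

/-- Expanding `(z b^n; b)_∞` by Euler's identity turns the Hahn–Exton function into an absolutely
convergent double series. -/
lemma summable_hahnExton_double {b : ℝ} (hb0 : 0 < b) (hb1 : b < 1) (w z : ℝ) :
    Summable fun x : ℕ × ℕ =>
      eulerCoeff b x.1 * w ^ x.1 * (eulerCoeff b x.2 * (z * b ^ x.1) ^ x.2) := by
  have h := summable_mul_of_summable_norm (f := fun n => |eulerCoeff b n| * |w| ^ n)
    (g := fun n => |eulerCoeff b n| * |z| ^ n)
    (by simpa using summable_eulerCoeff hb0 hb1 w) (by simpa using summable_eulerCoeff hb0 hb1 z)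
  refine Summable.of_norm_bounded h fun x => ?_
  simp only [norm_mul, norm_pow, Real.norm_eq_abs, abs_of_pos hb0]
  gcongr
  exact mul_le_of_le_one_right (abs_nonneg z) (pow_le_one₀ hb0.le hb1.le)

lemma hasSum_hahnExton_inner {b : ℝ} (hb0 : 0 < b) (hb1 : b < 1) (w z : ℝ) (n : ℕ) :
    HasSum (fun m => eulerCoeff b n * w ^ n * (eulerCoeff b m * (z * b ^ n) ^ m))
      (eulerCoeff b n * w ^ n * qPochInf (z * b ^ n) b) :=
  (hasSum_eulerCoeff hb0 hb1 (z * b ^ n)).mul_left _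

lemma summable_hahnExton {b : ℝ} (hb0 : 0 < b) (hb1 : b < 1) (w z : ℝ) :
    Summable fun n => eulerCoeff b n * w ^ n * qPochInf (z * b ^ n) b := by
  simpa only [(hasSum_hahnExton_inner hb0 hb1 w z _).tsum_eq] using
    (summable_hahnExton_double hb0 hb1 w z).prod

/-- The double series of the Hahn–Exton function is symmetric in the two arguments. -/
lemma hahnExton_comm {b : ℝ} (hb0 : 0 < b) (hb1 : b < 1) (w z : ℝ) :
    hahnExton b w z = hahnExton b z w := by
  have h := Summable.tsum_comm
    (f := fun n m => eulerCoeff b n * w ^ n * (eulerCoeff b m * (z * b ^ n) ^ m))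
    (summable_hahnExton_double hb0 hb1 w z)
  simp only [(hasSum_hahnExton_inner hb0 hb1 w z _).tsum_eq] at h
  rw [hahnExton, ← h, hahnExton]
  refine tsum_congr fun m => ?_
  rw [← (hasSum_hahnExton_inner hb0 hb1 z w m).tsum_eq]
  refine tsum_congr fun n => ?_
  rw [mul_pow, mul_pow, ← pow_mul, ← pow_mul, mul_comm m n]
  ring

/-- The factor `(b^{1+j}; b)_∞` vanishes for `j < 0` and equals `(b; b)_∞ / (b; b)_j` otherwise, so
its generating function over `ℤ` is given by Euler's second identity. -/
lemma hasSum_qPochInf_zpow {b t : ℝ} (hb0 : 0 < b) (hb1 : b < 1) (ht : 1 < t) :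
    HasSum (fun j : ℤ => qPochInf (b ^ (1 + j)) b * t ^ (-j)) (qPochInf b b / qPochInf t⁻¹ b) ∧
      Summable (fun j : ℤ => ‖qPochInf (b ^ (1 + j)) b * t ^ (-j)‖) := by
  have hb : |b| < 1 := by rwa [abs_of_pos hb0]
  have ht0 : 0 < t := by linarith
  have hx : |t⁻¹| < 1 := by rw [abs_of_pos (by positivity)]; exact inv_lt_one_of_one_lt₀ ht
  have hzero : ∀ j : ℤ, j ∉ Set.range (Nat.cast : ℕ → ℤ) →
      qPochInf (b ^ (1 + j)) b * t ^ (-j) = 0 := by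
    intro j hj
    have hj0 : j < 0 := by
      by_contra! h
      exact hj ⟨j.toNat, Int.toNat_of_nonneg h⟩
    -- the factor of index `i = -1 - j` in the infinite product is zero
    obtain ⟨i, hi⟩ : ∃ i : ℕ, j = -1 - i := ⟨(-1 - j).toNat, by omega⟩
    have e : b ^ (1 + j) * b ^ i = 1 := by
      rw [← zpow_natCast, ← zpow_add₀ hb0.ne', hi, show 1 + (-1 - (i : ℤ)) + i = 0 by ring,
        zpow_zero]
    rw [← qPoch_mul_qPochInf (b ^ (1 + j)) hb i, e, qPochInf_one hb, mul_zero, zero_mul]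
  have hcoe : (fun j : ℤ => qPochInf (b ^ (1 + j)) b * t ^ (-j)) ∘ (Nat.cast : ℕ → ℤ) =
      fun n : ℕ => qPochInf b b * ((qPoch b b n)⁻¹ * t⁻¹ ^ n) := by
    funext n
    have h1 := qPoch_mul_qPochInf b hb n
    have h2 := (qPoch_pos hb0 hb1 hb1 n).ne'
    have e : b ^ (1 + (n : ℤ)) = b * b ^ n := by rw [zpow_add₀ hb0.ne', zpow_one, zpow_natCast]
    simp only [Function.comp_apply]
    rw [e, zpow_neg, zpow_natCast, inv_pow, ← h1]
    field_simp
  have hs : HasSum (fun n : ℕ => qPochInf b b * ((qPoch b b n)⁻¹ * t⁻¹ ^ n))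
      (qPochInf b b / qPochInf t⁻¹ b) := by
    have h := tsum_inv_qPoch_mul_qPochInf hb0 hb1 hx
    rw [div_eq_mul_inv, ← eq_inv_of_mul_eq_one_left h]
    have h' : Summable fun n : ℕ => (qPoch b b n)⁻¹ * t⁻¹ ^ n :=
      Summable.of_norm (by
        simpa only [norm_mul, norm_pow, Real.norm_eq_abs] using summable_inv_qPoch hb0 hb1 hx)
    exact h'.hasSum.mul_left _
  have hinj : Function.Injective (Nat.cast : ℕ → ℤ) := Nat.cast_injective
  rw [← hcoe] at hs
  have key := (hinj.hasSum_iff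
    (f := fun j : ℤ => qPochInf (b ^ (1 + j)) b * t ^ (-j)) hzero).1 hs
  exact ⟨key, key.summable.norm⟩

/-- The Mellin-type sum of the Hahn–Exton function over the lattice, with absolute convergence for
every weight `t > 1`: by symmetry the values at `b^{1-k}` decay superexponentially as `k → ∞`. -/
lemma hasSum_zpow_mul_hahnExton {b t : ℝ} (hb0 : 0 < b) (hb1 : b < 1) (ht : 1 < t) (w : ℝ) :
    HasSum (fun k : ℤ => t ^ k * hahnExton b w (b ^ (1 - k)))
      (qPochInf (w * t) b * (qPochInf b b / qPochInf t⁻¹ b)) := by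
  have ht0 : 0 < t := by linarith
  obtain ⟨h1, h2⟩ := hasSum_qPochInf_zpow hb0 hb1 ht
  have h3 := (hasSum_eulerCoeff hb0 hb1 (w * t)).mul h1
    (summable_mul_of_summable_norm (hasSum_eulerCoeff hb0 hb1 (w * t)).summable.norm h2)
  -- the exponent of `t` in the product of the two generating functions is `k = n - j`
  let e : ℤ × ℕ ≃ ℕ × ℤ :=
    { toFun := fun x => (x.2, x.2 - x.1)
      invFun := fun x => (x.1 - x.2, x.1)
      left_inv := fun x => by simp
      right_inv := fun x => by simp }
  refine ((e.hasSum_iff).2 h3).prod_fiberwise fun k => ?_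
  have h4 := (summable_hahnExton hb0 hb1 w (b ^ (1 - k))).hasSum.mul_left (t ^ k)
  rw [← hahnExton] at h4
  convert h4 using 2 with n
  simp only [Function.comp_apply, e, Equiv.coe_fn_mk]
  have e1 : b ^ (1 - k) * b ^ n = b ^ (1 + ((n : ℤ) - k)) := by
    rw [← zpow_natCast, ← zpow_add₀ hb0.ne']; congr 1; ring
  have e2 : t ^ (-((n : ℤ) - k)) = t ^ k * (t ^ n)⁻¹ := by
    rw [neg_sub, zpow_sub₀ ht0.ne', zpow_natCast, div_eq_mul_inv]
  rw [e1, e2, mul_pow]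
  field_simp

/-! ### The lattice orthogonality argument -/

/-- Two sequences on `ℤ` that satisfy the first-order system of the `q`-sine and the `q`-cosine on
the lattice, with the decay at `+∞` and the value at `-∞` that single out those two solutions:
the correlation `∑ c (k + d) s k` is a step function of `d`. -/
lemma tsum_shift_mul_eq_ite {r : ℝ} (hr : 1 < r) {c s : ℤ → ℝ}
    (hs : ∀ k, s k - s (k - 1) = r ^ k * c k) (hc : ∀ k, c (k + 1) - c k = -(r ^ k * s k))
    (hss : Summable s) {C : ℝ} (hC : ∀ k, |c k| ≤ C) (hbot : Tendsto c atBot (𝓝 1))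
    (htop : Tendsto c atTop (𝓝 0))
    (d : ℤ) : ∑' k, c (k + d) * s k = if d ≤ 0 then ∑' k, s k else 0 := by
  have hr0 : 0 < r := by linarith
  -- products with a bounded sequence
  have hmul : ∀ {f g : ℤ → ℝ} {B : ℝ}, Summable f → (∀ k, |g k| ≤ B) →
      Summable fun k => g k * f k := fun {f g B} hf hg =>
    Summable.of_norm_bounded (hf.norm.mul_left B) fun k => by
      rw [norm_mul]; exact mul_le_mul_of_nonneg_right (hg k) (norm_nonneg _)
  set a : ℤ → ℝ := fun d => ∑' k, c (k + d) * s k with ha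
  have hsum : ∀ d, Summable fun k => c (k + d) * s k := fun d => hmul hss fun k => hC _
  -- summation by parts in the cosine
  have hS : ∀ d, a d - a (d + 1) = r ^ d * ∑' k, r ^ k * s k * s (k + d) := fun d => by
    rw [ha, ← (hsum d).tsum_sub (hsum (d + 1)), ← tsum_mul_left]
    refine tsum_congr fun k => ?_
    have h := hc (k + d)
    rw [zpow_add₀ hr0.ne', add_assoc] at h
    linear_combination (-s k) * h
  have hSsymm : ∀ d, ∑' k, r ^ k * s k * s (k + -d) = r ^ d * ∑' k, r ^ k * s k * s (k + d) :=
    fun d => by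
      rw [← (Equiv.addRight d).tsum_eq (fun k => r ^ k * s k * s (k + -d)), ← tsum_mul_left]
      refine tsum_congr fun k => ?_
      simp only [Equiv.coe_addRight, add_neg_cancel_right, zpow_add₀ hr0.ne']
      ring
  -- summation by parts in the sine
  have hB : ∀ d, a d - a (d + 1) = ∑' k, r ^ k * c k * c (k + d) := fun d => by
    have e : a (d + 1) = ∑' k, c (k + d) * s (k - 1) := by
      simp only [ha]
      rw [← (Equiv.subRight (1 : ℤ)).tsum_eq (fun k => c (k + (d + 1)) * s k)]
      refine tsum_congr fun k => ?_
      simp only [Equiv.subRight_apply]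
      rw [show k - 1 + (d + 1) = k + d by ring]
    have h1 : Summable fun k => c (k + d) * s (k - 1) :=
      hmul ((Equiv.subRight (1 : ℤ)).summable_iff.2 hss) fun k => hC _
    rw [e, ha, ← (hsum d).tsum_sub h1]
    refine tsum_congr fun k => ?_
    linear_combination c (k + d) * hs k
  have hBsymm : ∀ d, r ^ d * ∑' k, r ^ k * c k * c (k + d) = ∑' k, r ^ k * c k * c (k + -d) :=
    fun d => by
      rw [← (Equiv.addRight d).tsum_eq (fun k => r ^ k * c k * c (k + -d)), ← tsum_mul_left]
      refine tsum_congr fun k => ?_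
      simp only [Equiv.coe_addRight, add_neg_cancel_right, zpow_add₀ hr0.ne']
      ring
  -- the two reflection formulas carry different powers of `r`, unless `d = 0`
  have hconst : ∀ d, d ≠ 0 → a d = a (d + 1) := fun d hd => by
    have h1 := hS (-d)
    rw [hSsymm, ← mul_assoc, ← zpow_add₀ hr0.ne', neg_add_cancel, zpow_zero, one_mul] at h1
    have h2 := hB (-d)
    rw [← hBsymm, ← hB] at h2
    have h3 := hS d
    rw [← h1, h2, ← mul_assoc, ← zpow_add₀ hr0.ne'] at h3
    have h4 : r ^ (d + d) ≠ 1 := fun h => by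
      rw [zpow_eq_one_iff_right₀ hr0.le hr.ne'] at h
      omega
    have h5 : (a d - a (d + 1)) * (r ^ (d + d) - 1) = 0 := by linear_combination -h3
    exact sub_eq_zero.1 ((mul_eq_zero.1 h5).resolve_right (sub_ne_zero.2 h4))
  have hlim : ∀ {l : Filter ℤ} {L : ℝ}, (∀ k, Tendsto (fun d => c (k + d)) l (𝓝 L)) →
      Tendsto a l (𝓝 (∑' k, L * s k)) := fun {l L} hl =>
    tendsto_tsum_of_dominated_convergence (hss.norm.mul_left C)
      (fun k => (hl k).mul_const _)
      (Eventually.of_forall fun d k => by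
        rw [norm_mul]; exact mul_le_mul_of_nonneg_right (hC _) (norm_nonneg _))
  have hltop : Tendsto a atTop (𝓝 0) := by
    simpa using hlim (l := atTop) fun k => htop.comp (tendsto_atTop_add_const_left _ k tendsto_id)
  have hlbot : Tendsto a atBot (𝓝 (∑' k, s k)) := by
    simpa using hlim (l := atBot) fun k => hbot.comp (tendsto_atBot_add_const_left _ k tendsto_id)
  change a d = _
  split_ifs with hd
  · have h : ∀ n : ℕ, a (d - n) = a d := fun n => by
      induction n with
      | zero => simp
      | succ n ih =>
        rw [hconst (d - (n + 1 : ℕ)) (by push_cast; omega), ← ih]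
        congr 1; push_cast; ring
    refine tendsto_nhds_unique (l := (atTop : Filter ℕ))
      (tendsto_const_nhds.congr fun n => (h n).symm) (hlbot.comp ?_)
    exact tendsto_atBot_add_const_left _ d
      (tendsto_neg_atTop_atBot.comp tendsto_natCast_atTop_atTop)
  · have h : ∀ n : ℕ, a (d + n) = a d := fun n => by
      induction n with
      | zero => simp
      | succ n ih =>
        rw [← ih, hconst (d + n) (by omega)]
        congr 1; push_cast; ring
    refine tendsto_nhds_unique (l := (atTop : Filter ℕ))
      (tendsto_const_nhds.congr fun n => (h n).symm) (hltop.comp ?_)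
    exact tendsto_atTop_add_const_left _ d tendsto_natCast_atTop_atTop

/-! ### The `q`-sine and the `q`-cosine -/

/-- The terms of the `q`-cosine series in the variable `p = q^{-2}`. -/
noncomputable def cosTerm (p z : ℝ) (n : ℕ) : ℝ :=
  (-1) ^ n * p ^ (n * (n + 1)) * z ^ (2 * n) / qPoch p p (2 * n)

/-- The terms of the `q`-sine series in the variable `p = q^{-2}`. -/
noncomputable def sinTerm (p z : ℝ) (n : ℕ) : ℝ :=
  (-1) ^ n * p ^ (n * (n + 1)) * z ^ (2 * n + 1) / qPoch p p (2 * n + 1)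

lemma zpow_neg_two_mul (q : ℝ) (n : ℕ) :
    q ^ (-(2 * (n : ℤ) * ((n : ℤ) + 1))) = (q ^ (-2 : ℤ)) ^ (n * (n + 1)) := by
  rw [← zpow_natCast, ← zpow_mul]
  congr 1
  push_cast
  ring

lemma cosQ_eq_tsum (q z : ℝ) : cosQ q z = ∑' n, cosTerm (q ^ (-2 : ℤ)) z n :=
  tsum_congr fun n => by rw [cosTerm, zpow_neg_two_mul]

lemma sinQ_eq_tsum (q z : ℝ) : sinQ q z = ∑' n, sinTerm (q ^ (-2 : ℤ)) z n :=
  tsum_congr fun n => by rw [sinTerm, zpow_neg_two_mul]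

lemma mul_succ_eq_two_mul_choose (n : ℕ) : n * (n + 1) = 2 * (n.choose 2 + n) := by
  induction n with
  | zero => simp
  | succ n ih =>
    have : (n + 1).choose 2 = n + n.choose 2 := by
      rw [Nat.choose_succ_succ' n 1, Nat.choose_one_right]
    rw [this]
    linarith

lemma qPoch_two_mul (p : ℝ) (n : ℕ) :
    qPoch p p (2 * n) = qPoch p (p ^ 2) n * qPoch (p ^ 2) (p ^ 2) n := by
  induction n with
  | zero => simp [qPoch]
  | succ n ih =>
    rw [show 2 * (n + 1) = 2 * n + 1 + 1 by ring, qPoch_succ, qPoch_succ, ih, qPoch_succ, qPoch_succ]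
    ring

lemma qPoch_two_mul_add_one (p : ℝ) (n : ℕ) :
    qPoch p p (2 * n + 1) = (1 - p) * qPoch (p ^ 3) (p ^ 2) n * qPoch (p ^ 2) (p ^ 2) n := by
  induction n with
  | zero => simp [qPoch]
  | succ n ih =>
    rw [show 2 * (n + 1) + 1 = 2 * n + 1 + 1 + 1 by ring, qPoch_succ, qPoch_succ, ih, qPoch_succ,
      qPoch_succ]
    ring

lemma cosTerm_eq (p z : ℝ) (n : ℕ) :
    cosTerm p z n = eulerCoeff (p ^ 2) n * (p ^ 2 * z ^ 2) ^ n / qPoch p (p ^ 2) n := by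
  rw [cosTerm, eulerCoeff, qPoch_two_mul, mul_succ_eq_two_mul_choose, pow_mul, pow_add, pow_mul z,
    mul_pow (p ^ 2) (z ^ 2), div_mul_eq_mul_div, div_div, mul_comm (qPoch p (p ^ 2) n)]
  ring

lemma sinTerm_eq (p z : ℝ) (n : ℕ) :
    sinTerm p z n =
      z / (1 - p) * (eulerCoeff (p ^ 2) n * (p ^ 2 * z ^ 2) ^ n / qPoch (p ^ 3) (p ^ 2) n) := by
  rw [sinTerm, eulerCoeff, qPoch_two_mul_add_one, mul_succ_eq_two_mul_choose, pow_mul, pow_add,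
    pow_succ z, pow_mul z, mul_pow (p ^ 2) (z ^ 2)]
  simp only [div_eq_mul_inv, mul_inv]
  ring

lemma hasSum_cosTerm {p : ℝ} (hp0 : 0 < p) (hp1 : p < 1) (z : ℝ) :
    HasSum (cosTerm p z) (hahnExton (p ^ 2) (p ^ 2 * z ^ 2) p / qPochInf p (p ^ 2)) := by
  have hb0 : 0 < p ^ 2 := by positivity
  have hb1 : p ^ 2 < 1 := pow_lt_one₀ hp0.le hp1 two_ne_zero
  have hne : qPochInf p (p ^ 2) ≠ 0 := qPochInf_ne_zero hb0 hb1 (by rwa [abs_of_pos hp0])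
  have h := (summable_hahnExton hb0 hb1 (p ^ 2 * z ^ 2) p).hasSum.div_const (qPochInf p (p ^ 2))
  refine h.congr_fun fun n => ?_
  have h1 := qPoch_mul_qPochInf p (b := p ^ 2) (by rwa [abs_of_pos hb0]) n
  have h2 := (qPoch_pos hb0 hb1 hp1 n).ne'
  rw [cosTerm_eq, div_eq_div_iff h2 hne, ← h1]
  ring

lemma hasSum_sinTerm {p : ℝ} (hp0 : 0 < p) (hp1 : p < 1) (z : ℝ) :
    HasSum (sinTerm p z)
      (z * (hahnExton (p ^ 2) (p ^ 2 * z ^ 2) (p ^ 3) / qPochInf p (p ^ 2))) := by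
  have hb0 : 0 < p ^ 2 := by positivity
  have hb1 : p ^ 2 < 1 := pow_lt_one₀ hp0.le hp1 two_ne_zero
  have hb : |p ^ 2| < 1 := by rwa [abs_of_pos hb0]
  have hp3 : p ^ 3 < 1 := pow_lt_one₀ hp0.le hp1 three_ne_zero
  have hne : qPochInf p (p ^ 2) ≠ 0 := qPochInf_ne_zero hb0 hb1 (by rwa [abs_of_pos hp0])
  have h0 : qPochInf p (p ^ 2) = (1 - p) * qPochInf (p ^ 3) (p ^ 2) := by
    rw [← qPoch_mul_qPochInf p hb 1]
    simp [qPoch, ← pow_succ']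
  have h := ((summable_hahnExton hb0 hb1 (p ^ 2 * z ^ 2) (p ^ 3)).hasSum.div_const
    (qPochInf p (p ^ 2))).mul_left z
  refine h.congr_fun fun n => ?_
  have h1 := qPoch_mul_qPochInf (p ^ 3) hb n
  have h2 := (qPoch_pos hb0 hb1 hp3 n).ne'
  have h3 : 1 - p ≠ 0 := by linarith
  rw [h0] at hne ⊢
  rw [sinTerm_eq, div_mul_eq_mul_div, mul_div_assoc, div_div, ← h1]
  rw [← h1] at hne
  congr 1
  rw [div_eq_div_iff (mul_ne_zero h2 h3) hne]
  ring

section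

variable {q : ℝ}

lemma zpow_neg_two_pos (hq : 1 < q) : 0 < q ^ (-2 : ℤ) := by positivity

lemma zpow_neg_two_lt_one (hq : 1 < q) : q ^ (-2 : ℤ) < 1 :=
  zpow_lt_one_of_neg₀ hq (by norm_num)

lemma zpow_neg_four_eq (q : ℝ) : q ^ (-4 : ℤ) = (q ^ (-2 : ℤ)) ^ 2 := by
  rw [← zpow_natCast, ← zpow_mul]; norm_num

lemma zpow_neg_six_eq (q : ℝ) : q ^ (-6 : ℤ) = (q ^ (-2 : ℤ)) ^ 3 := by
  rw [← zpow_natCast, ← zpow_mul]; norm_num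

lemma hasSum_cosQ (hq : 1 < q) (z : ℝ) : HasSum (cosTerm (q ^ (-2 : ℤ)) z) (cosQ q z) :=
  cosQ_eq_tsum q z ▸
    (hasSum_cosTerm (zpow_neg_two_pos hq) (zpow_neg_two_lt_one hq) z).summable.hasSum

lemma hasSum_sinQ (hq : 1 < q) (z : ℝ) : HasSum (sinTerm (q ^ (-2 : ℤ)) z) (sinQ q z) :=
  sinQ_eq_tsum q z ▸
    (hasSum_sinTerm (zpow_neg_two_pos hq) (zpow_neg_two_lt_one hq) z).summable.hasSum

lemma sinQ_sub_sinQ (hq : 1 < q) (z : ℝ) :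
    sinQ q z - sinQ q (q ^ (-2 : ℤ) * z) = z * cosQ q z := by
  have hp0 := zpow_neg_two_pos hq
  have hp1 := zpow_neg_two_lt_one hq
  refine ((hasSum_sinQ hq z).sub (hasSum_sinQ hq _)).unique ?_
  refine ((hasSum_cosQ hq z).mul_left z).congr_fun fun n => ?_
  generalize q ^ (-2 : ℤ) = p at *
  have h1 := (qPoch_pos hp0 hp1 hp1 (2 * n)).ne'
  have h2 := (one_sub_mul_pow_pos hp0 hp1 hp1 (2 * n)).ne'
  rw [sinTerm, sinTerm, cosTerm, qPoch_succ, ← sub_div, ← mul_div_assoc,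
    div_eq_div_iff (mul_ne_zero h1 h2) h1]
  ring

lemma cosQ_sub_cosQ (hq : 1 < q) (z : ℝ) :
    cosQ q z - cosQ q (q ^ (-2 : ℤ) * z) =
      -(q ^ (-2 : ℤ) * z * sinQ q (q ^ (-2 : ℤ) * z)) := by
  have hp0 := zpow_neg_two_pos hq
  have hp1 := zpow_neg_two_lt_one hq
  have h := (hasSum_cosQ hq z).sub (hasSum_cosQ hq (q ^ (-2 : ℤ) * z))
  have h' := ((hasSum_sinQ hq (q ^ (-2 : ℤ) * z)).mul_left (q ^ (-2 : ℤ) * z)).neg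
  rw [← h.tsum_eq, h.summable.tsum_eq_zero_add, ← h'.tsum_eq]
  have h0 : cosTerm (q ^ (-2 : ℤ)) z 0 - cosTerm (q ^ (-2 : ℤ)) (q ^ (-2 : ℤ) * z) 0 = 0 := by
    simp [cosTerm]
  rw [h0, zero_add]
  refine tsum_congr fun n => ?_
  generalize q ^ (-2 : ℤ) = p at *
  have h1 := (qPoch_pos hp0 hp1 hp1 (2 * n + 1)).ne'
  have h2 := (one_sub_mul_pow_pos hp0 hp1 hp1 (2 * n + 1)).ne'
  rw [sinTerm, cosTerm, cosTerm, show 2 * (n + 1) = 2 * n + 1 + 1 by ring, qPoch_succ, ← sub_div,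
    ← mul_div_assoc, ← neg_div, div_eq_div_iff (mul_ne_zero h1 h2) h1]
  ring

/-! ### Values on the lattice -/

lemma neg_two_zpow_mul (hq : 1 < q) (k : ℤ) : q ^ (-2 : ℤ) * q ^ (2 * k) = q ^ (2 * (k - 1)) := by
  rw [← zpow_add₀ (by positivity)]
  congr 1
  ring

lemma sinQ_lattice_sub (hq : 1 < q) (k : ℤ) :
    sinQ q (q ^ (2 * k)) - sinQ q (q ^ (2 * (k - 1))) = (q ^ 2) ^ k * cosQ q (q ^ (2 * k)) := by
  rw [← neg_two_zpow_mul hq, sinQ_sub_sinQ hq, zpow_mul]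
  norm_cast

lemma cosQ_lattice_sub (hq : 1 < q) (k : ℤ) :
    cosQ q (q ^ (2 * (k + 1))) - cosQ q (q ^ (2 * k)) = -((q ^ 2) ^ k * sinQ q (q ^ (2 * k))) := by
  have h := cosQ_sub_cosQ hq (q ^ (2 * (k + 1)))
  rw [neg_two_zpow_mul hq, add_sub_cancel_right] at h
  rw [h, zpow_mul]
  norm_cast

lemma hahnExton_arg (hq : 1 < q) (k : ℤ) :
    ((q ^ (-2 : ℤ)) ^ 2) * (q ^ (2 * k)) ^ 2 = ((q ^ (-2 : ℤ)) ^ 2) ^ (1 - k) := by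
  have hq0 : q ≠ 0 := by positivity
  rw [← zpow_natCast, ← zpow_natCast, ← zpow_mul, ← zpow_mul, ← zpow_mul, ← zpow_add₀ hq0]
  congr 1
  push_cast
  ring

/-- The form of the `q`-cosine on the lattice that exhibits its decay, obtained from the power series
by exchanging the arguments of the Hahn–Exton function. -/
lemma cosQ_lattice (hq : 1 < q) (k : ℤ) :
    cosQ q (q ^ (2 * k)) =
      hahnExton ((q ^ (-2 : ℤ)) ^ 2) (q ^ (-2 : ℤ)) (((q ^ (-2 : ℤ)) ^ 2) ^ (1 - k)) /
        qPochInf (q ^ (-2 : ℤ)) ((q ^ (-2 : ℤ)) ^ 2) := by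
  have hp0 := zpow_neg_two_pos hq
  have hp1 := zpow_neg_two_lt_one hq
  rw [cosQ_eq_tsum, (hasSum_cosTerm hp0 hp1 _).tsum_eq, hahnExton_arg hq,
    hahnExton_comm (by positivity) (pow_lt_one₀ hp0.le hp1 two_ne_zero)]

/-- The analogue of `cosQ_lattice` for the `q`-sine. -/
lemma sinQ_lattice (hq : 1 < q) (k : ℤ) :
    sinQ q (q ^ (2 * k)) = (q ^ 2) ^ k *
      (hahnExton ((q ^ (-2 : ℤ)) ^ 2) ((q ^ (-2 : ℤ)) ^ 3) (((q ^ (-2 : ℤ)) ^ 2) ^ (1 - k)) /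
        qPochInf (q ^ (-2 : ℤ)) ((q ^ (-2 : ℤ)) ^ 2)) := by
  have hp0 := zpow_neg_two_pos hq
  have hp1 := zpow_neg_two_lt_one hq
  rw [sinQ_eq_tsum, (hasSum_sinTerm hp0 hp1 _).tsum_eq, hahnExton_arg hq,
    hahnExton_comm (by positivity) (pow_lt_one₀ hp0.le hp1 two_ne_zero), zpow_mul]
  norm_cast

lemma summable_zpow_mul_cosQ (hq : 1 < q) :
    Summable fun k : ℤ => (q ^ 2) ^ k * cosQ q (q ^ (2 * k)) := by
  have hp0 := zpow_neg_two_pos hq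
  have hp1 := zpow_neg_two_lt_one hq
  have h := (hasSum_zpow_mul_hahnExton (b := (q ^ (-2 : ℤ)) ^ 2) (by positivity)
    (pow_lt_one₀ hp0.le hp1 two_ne_zero) (one_lt_pow₀ hq two_ne_zero)
    (q ^ (-2 : ℤ))).summable.div_const (qPochInf (q ^ (-2 : ℤ)) ((q ^ (-2 : ℤ)) ^ 2))
  refine h.congr fun k => ?_
  rw [cosQ_lattice hq, mul_div_assoc]

/-- The total mass `∑ sin_q(q^{2k})`, which is a value of the Mellin-type sum. -/
lemma hasSum_sinQ_lattice (hq : 1 < q) :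
    HasSum (fun k : ℤ => sinQ q (q ^ (2 * k))) ((normQ q ^ 2)⁻¹) := by
  have hp0 := zpow_neg_two_pos hq
  have hp1 := zpow_neg_two_lt_one hq
  have h := (hasSum_zpow_mul_hahnExton (b := (q ^ (-2 : ℤ)) ^ 2) (by positivity)
    (pow_lt_one₀ hp0.le hp1 two_ne_zero) (one_lt_pow₀ hq two_ne_zero)
    ((q ^ (-2 : ℤ)) ^ 3)).div_const (qPochInf (q ^ (-2 : ℤ)) ((q ^ (-2 : ℤ)) ^ 2))
  have e1 : (q ^ 2)⁻¹ = q ^ (-2 : ℤ) := by rw [zpow_neg]; norm_cast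
  have e2 : (q ^ (-2 : ℤ)) ^ 3 * q ^ 2 = (q ^ (-2 : ℤ)) ^ 2 := by
    rw [← e1]; field_simp
  rw [e1, e2] at h
  refine Eq.mp (congrArg₂ HasSum (funext fun k => ?_) ?_) h
  · rw [sinQ_lattice hq, mul_div_assoc]
  · rw [normQ, zpow_neg_four_eq, div_pow, inv_div]
    ring

lemma normQ_ne_zero (hq : 1 < q) : normQ q ≠ 0 := by
  have hp0 := zpow_neg_two_pos hq
  have hp1 := zpow_neg_two_lt_one hq
  have hb0 : 0 < (q ^ (-2 : ℤ)) ^ 2 := by positivity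
  have hb1 := pow_lt_one₀ hp0.le hp1 two_ne_zero
  rw [normQ, zpow_neg_four_eq]
  exact div_ne_zero (qPochInf_ne_zero hb0 hb1 (by rwa [abs_of_pos hp0]))
    (qPochInf_ne_zero hb0 hb1 (by rwa [abs_of_pos hb0]))

lemma tendsto_cosQ_lattice_atTop (hq : 1 < q) :
    Tendsto (fun k : ℤ => cosQ q (q ^ (2 * k))) atTop (𝓝 0) := by
  have h := (summable_zpow_mul_cosQ hq).tendsto_cofinite_zero
  rw [Int.cofinite_eq, tendsto_sup] at h
  refine squeeze_zero_norm' ?_ (by simpa only [norm_zero] using h.2.norm)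
  filter_upwards [eventually_ge_atTop 0] with k hk
  rw [norm_mul]
  refine le_mul_of_one_le_left (norm_nonneg _) ?_
  rw [Real.norm_of_nonneg (by positivity)]
  exact one_le_zpow₀ (one_le_pow₀ hq.le) hk

lemma cosTerm_eq_mul_sq_pow (p z : ℝ) (n : ℕ) : cosTerm p z n = cosTerm p 1 n * (z ^ 2) ^ n := by
  rw [cosTerm, cosTerm, ← pow_mul]
  ring

lemma tendsto_cosQ_lattice_atBot (hq : 1 < q) :
    Tendsto (fun k : ℤ => cosQ q (q ^ (2 * k))) atBot (𝓝 1) := by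
  have hs : Summable fun n => |cosTerm (q ^ (-2 : ℤ)) 1 n| * 1 ^ n := by
    simpa using (hasSum_cosQ hq 1).summable.norm
  have hy : Tendsto (fun k : ℤ => (q ^ (2 * k)) ^ 2) atBot (𝓝 0) := by
    have h : Tendsto (fun k : ℤ => (q ^ 4)⁻¹ ^ (-k).toNat) atBot (𝓝 0) :=
      (tendsto_pow_atTop_nhds_zero_of_lt_one (by positivity)
        (inv_lt_one_of_one_lt₀ (one_lt_pow₀ hq four_ne_zero))).comp
        ((tendsto_atTop_atTop.2 fun n => ⟨n, fun k hk => by omega⟩ :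
          Tendsto Int.toNat atTop atTop).comp tendsto_neg_atBot_atTop)
    refine h.congr' ?_
    filter_upwards [eventually_le_atBot 0] with k hk
    obtain ⟨n, rfl⟩ : ∃ n : ℕ, k = -n := ⟨(-k).toNat, by omega⟩
    rw [neg_neg, Int.toNat_natCast, mul_neg, zpow_neg, inv_pow, inv_pow, ← pow_mul]
    norm_cast
    rw [← pow_mul]
    ring_nf
  have h := tendsto_tsum_mul_pow hs hy (by
    filter_upwards [eventually_le_atBot 0] with k hk
    rw [abs_of_nonneg (by positivity)]
    exact pow_le_one₀ (by positivity) (zpow_le_one_of_nonpos₀ hq.le (by omega)))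
  have h0 : cosTerm (q ^ (-2 : ℤ)) 1 0 = 1 := by simp [cosTerm, qPoch]
  rw [h0] at h
  refine h.congr fun k => ?_
  rw [cosQ_eq_tsum]
  exact tsum_congr fun n => (cosTerm_eq_mul_sq_pow _ _ _).symm

lemma exists_abs_cosQ_lattice_le (hq : 1 < q) : ∃ C, ∀ k : ℤ, |cosQ q (q ^ (2 * k))| ≤ C := by
  obtain ⟨K, hK⟩ := eventually_atTop.1
    ((tendsto_cosQ_lattice_atTop hq).abs.eventually_le_const (u := 1) (by simp))
  obtain ⟨L, hL⟩ := eventually_atBot.1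
    ((tendsto_cosQ_lattice_atBot hq).abs.eventually_le_const (u := 2) (by simp))
  refine ⟨2 + ∑ k ∈ Finset.Icc L K, |cosQ q (q ^ (2 * k))|, fun k => ?_⟩
  have h0 : 0 ≤ ∑ k ∈ Finset.Icc L K, |cosQ q (q ^ (2 * k))| :=
    Finset.sum_nonneg fun _ _ => abs_nonneg _
  rcases le_total K k with h | h
  · linarith [hK k h]
  rcases le_total k L with h' | h'
  · linarith [hL k h']
  · linarith [Finset.single_le_sum (f := fun k : ℤ => |cosQ q (q ^ (2 * k))|)
      (fun _ _ => abs_nonneg _) (Finset.mem_Icc.2 ⟨h', h⟩)]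

end

/-! ### Half-integer Hahn–Exton Bessel functions -/

section

variable {q : ℝ}

lemma zpow_rpow_eq_zpow (hq : 1 < q) {i j : ℤ} {x : ℝ} (h : (i : ℝ) * x = j) :
    (q ^ i) ^ x = q ^ j := by
  rw [← Real.rpow_intCast, ← Real.rpow_intCast, ← Real.rpow_mul (by positivity), h]

lemma qPoch_zero_left (b : ℝ) (n : ℕ) : qPoch 0 b n = 1 := by simp [qPoch]

lemma phi11_zero_left (c b w : ℝ) :
    phi11 0 c b w = ∑' n, eulerCoeff b n * w ^ n / qPoch c b n := by
  refine tsum_congr fun n => ?_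
  rw [qPoch_zero_left, eulerCoeff]
  simp only [div_eq_mul_inv, mul_inv]
  ring

lemma besselJ_neg_half (hq : 1 < q) (j : ℤ) :
    besselJ (q ^ (-4 : ℤ)) (-1 / 2) (q ^ (2 * j)) =
      q ^ (-j) * (normQ q * cosQ q (q ^ (2 * j))) := by
  have e1 : (q ^ (-4 : ℤ)) ^ ((-1 / 2 : ℝ) + 1) = q ^ (-2 : ℤ) :=
    zpow_rpow_eq_zpow hq (by norm_num)
  have e2 : (q ^ (2 * j)) ^ (-1 / 2 : ℝ) = q ^ (-j) :=
    zpow_rpow_eq_zpow hq (by push_cast; ring)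
  rw [besselJ, e1, e2, phi11_zero_left, cosQ_eq_tsum, normQ, mul_assoc]
  simp only [cosTerm_eq, zpow_neg_four_eq]

lemma besselJ_half (hq : 1 < q) (j : ℤ) :
    besselJ (q ^ (-4 : ℤ)) (1 / 2) (q ^ (2 * j)) =
      q ^ (-j) * (normQ q * sinQ q (q ^ (2 * j))) := by
  have hq0 : q ≠ 0 := by positivity
  have hp0 := zpow_neg_two_pos hq
  have hp1 := zpow_neg_two_lt_one hq
  have hb : |(q ^ (-2 : ℤ)) ^ 2| < 1 := by
    rw [abs_of_pos (by positivity)]; exact pow_lt_one₀ hp0.le hp1 two_ne_zero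
  have e1 : (q ^ (-4 : ℤ)) ^ ((1 / 2 : ℝ) + 1) = (q ^ (-2 : ℤ)) ^ 3 := by
    rw [← zpow_neg_six_eq]; exact zpow_rpow_eq_zpow hq (by norm_num)
  have e2 : (q ^ (2 * j)) ^ (1 / 2 : ℝ) = q ^ (-j) * q ^ (2 * j) := by
    rw [← zpow_add₀ hq0]; exact zpow_rpow_eq_zpow hq (by push_cast; ring)
  have h0 : qPochInf (q ^ (-2 : ℤ)) ((q ^ (-2 : ℤ)) ^ 2) =
      (1 - q ^ (-2 : ℤ)) * qPochInf ((q ^ (-2 : ℤ)) ^ 3) ((q ^ (-2 : ℤ)) ^ 2) := by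
    rw [← qPoch_mul_qPochInf (q ^ (-2 : ℤ)) hb 1, ← pow_mul, ← pow_succ']
    simp [qPoch]
  rw [besselJ, e1, e2, phi11_zero_left, sinQ_eq_tsum, normQ]
  simp only [sinTerm_eq, zpow_neg_four_eq, tsum_mul_left]
  rw [h0]
  have h3 : 1 - q ^ (-2 : ℤ) ≠ 0 := by linarith
  generalize q ^ (-2 : ℤ) = p at *
  field_simp

/-! ### The step function and its transform -/

/-- Telescoping over a half-line of `ℤ`. -/
lemma hasSum_Iic_sub {s : ℤ → ℝ} (hs : Summable s) (M : ℤ) :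
    HasSum (fun n : Set.Iic M => s n - s (n - 1)) (s M) := by
  refine (hasSum_subtype_iff_indicator (f := fun n : ℤ => s n - s (n - 1))).2 ?_
  have h1 := (hs.indicator (Set.Iic M)).hasSum
  have h2 := (hs.indicator (Set.Iic (M - 1))).hasSum
  have h3 := h1.sub ((Equiv.subRight (1 : ℤ)).hasSum_iff.2 h2)
  have h4 : ∑' n, (Set.Iic M).indicator s n - ∑' n, (Set.Iic (M - 1)).indicator s n = s M := by
    rw [← h1.summable.tsum_sub h2.summable, tsum_eq_single M]
    · simp
    · intro n hn
      have : n ≤ M ↔ n ≤ M - 1 := by omega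
      simp [Set.indicator, this]
  rw [h4] at h3
  refine h3.congr_fun fun n => ?_
  by_cases h : n ≤ M <;> simp [Set.indicator, h]

lemma zpow_mul_cosQ_lattice (hq : 1 < q) (k n : ℤ) :
    q ^ (2 * n) * cosQ q (q ^ (2 * (k + n))) =
      q ^ (-2 * k) * (sinQ q (q ^ (2 * (k + n))) - sinQ q (q ^ (2 * (k + (n - 1))))) := by
  have hq0 : q ≠ 0 := by positivity
  rw [← add_sub_assoc, sinQ_lattice_sub hq, ← mul_assoc]
  congr 1
  rw [← zpow_natCast, ← zpow_mul, ← zpow_add₀ hq0]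
  congr 1
  push_cast
  ring

lemma hasSum_Iic_sinQ_sub (hq : 1 < q) (k M : ℤ) :
    HasSum (fun n : Set.Iic M => sinQ q (q ^ (2 * (k + (n : ℤ)))) -
      sinQ q (q ^ (2 * (k + ((n : ℤ) - 1))))) (sinQ q (q ^ (2 * (k + M)))) :=
  hasSum_Iic_sub (s := fun n => sinQ q (q ^ (2 * (k + n))))
    ((Equiv.addLeft k).summable_iff.2 (hasSum_sinQ_lattice hq).summable) M

lemma hasSum_Iic_zpow_mul_cosQ (hq : 1 < q) (k M : ℤ) :
    HasSum (fun n : Set.Iic M => q ^ (2 * (n : ℤ)) * cosQ q (q ^ (2 * (k + (n : ℤ)))))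
      (q ^ (-2 * k) * sinQ q (q ^ (2 * (k + M)))) :=
  ((hasSum_Iic_sinQ_sub hq k M).mul_left (q ^ (-2 * k))).congr_fun fun _ =>
    zpow_mul_cosQ_lattice hq k _

lemma hasSum_mul_latticeStep (hq : 1 < q) (k M : ℤ) :
    HasSum (fun n : ℤ => q ^ (2 * n) * cosQ q (q ^ (2 * (k + n))) * latticeStep M n)
      (q ^ (-2 * k) * sinQ q (q ^ (2 * (k + M)))) := by
  have h := (hasSum_subtype_iff_indicator
    (f := fun n : ℤ => q ^ (2 * n) * cosQ q (q ^ (2 * (k + n))))).1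
    (hasSum_Iic_zpow_mul_cosQ hq k M)
  refine h.congr_fun fun n => ?_
  by_cases hn : n ≤ M <;> simp [latticeStep, hn]

lemma qCosTransform_latticeStep (hq : 1 < q) (k M : ℤ) :
    qCosTransform q (latticeStep M) k =
      normQ q * q ^ (-2 * k) * sinQ q (q ^ (2 * (k + M))) := by
  rw [qCosTransform, (hasSum_mul_latticeStep hq k M).tsum_eq, mul_assoc]

/-- Stokes' theorem for the `q`-sine: the `q`-integral of the symmetric `q`-derivative telescopes. -/
lemma qIntegral_qDeriv_sinQ (hq : 1 < q) (k M : ℤ) :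
    qIntegral q (qDeriv q (fun x => sinQ q (x * q ^ (2 * k)))) M = sinQ q (q ^ (2 * (k + M))) := by
  have hq0 : q ≠ 0 := by positivity
  have hd : q - q⁻¹ ≠ 0 := by
    have := inv_lt_one_of_one_lt₀ hq
    linarith
  rw [qIntegral, ← tsum_mul_left, ← (hasSum_Iic_sinQ_sub hq k M).tsum_eq]
  refine tsum_congr fun n => ?_
  have hx : q ^ (2 * (n : ℤ) - 1) ≠ 0 := zpow_ne_zero _ hq0
  have e1 : q * q ^ (2 * (n : ℤ) - 1) * q ^ (2 * k) = q ^ (2 * (k + (n : ℤ))) := by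
    rw [← zpow_one_add₀ hq0, ← zpow_add₀ hq0]; congr 1; ring
  have e2 : q⁻¹ * q ^ (2 * (n : ℤ) - 1) * q ^ (2 * k) = q ^ (2 * (k + ((n : ℤ) - 1))) := by
    rw [← zpow_neg_one, ← zpow_add₀ hq0, ← zpow_add₀ hq0]; congr 1; ring
  simp only [qDeriv, e1, e2]
  rw [← mul_assoc,
    mul_div_cancel₀ _ (mul_ne_zero hd hx)]

/-! ### The inverse transform -/

lemma summable_cosQ_mul_sinQ (hq : 1 < q) (n M : ℤ) :
    Summable fun k : ℤ => cosQ q (q ^ (2 * (k + n))) * sinQ q (q ^ (2 * (k + M))) := by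
  obtain ⟨C, hC⟩ := exists_abs_cosQ_lattice_le hq
  have h := (Equiv.addRight M).summable_iff.2 (hasSum_sinQ_lattice hq).summable
  refine Summable.of_norm_bounded (h.norm.mul_left C) fun k => ?_
  rw [norm_mul]
  exact mul_le_mul_of_nonneg_right (hC _) (norm_nonneg _)

lemma tsum_cosQ_mul_sinQ (hq : 1 < q) (n M : ℤ) :
    normQ q ^ 2 * ∑' k : ℤ, cosQ q (q ^ (2 * (k + n))) * sinQ q (q ^ (2 * (k + M))) =
      latticeStep M n := by
  obtain ⟨C, hC⟩ := exists_abs_cosQ_lattice_le hq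
  have hs := hasSum_sinQ_lattice hq
  have h := tsum_shift_mul_eq_ite (one_lt_pow₀ hq two_ne_zero)
    (c := fun k => cosQ q (q ^ (2 * k))) (s := fun k => sinQ q (q ^ (2 * k)))
    (sinQ_lattice_sub hq) (cosQ_lattice_sub hq) hs.summable hC (tendsto_cosQ_lattice_atBot hq)
    (tendsto_cosQ_lattice_atTop hq) (n - M)
  rw [← (Equiv.addRight M).tsum_eq, hs.tsum_eq] at h
  simp only [Equiv.coe_addRight, add_add_sub_cancel] at h
  have hN := pow_ne_zero 2 (normQ_ne_zero hq)
  rw [h, latticeStep]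
  by_cases hn : n ≤ M
  · simp [hn, mul_inv_cancel₀ hN]
  · simp [hn]

lemma inverse_term_eq (hq : 1 < q) (M n k : ℤ) :
    q ^ (2 * k) * cosQ q (q ^ (2 * (n + k))) * qCosTransform q (latticeStep M) k =
      normQ q * (cosQ q (q ^ (2 * (k + n))) * sinQ q (q ^ (2 * (k + M)))) := by
  have hk : q ^ (2 * k) * q ^ (-2 * k) = 1 := by
    rw [← zpow_add₀ (by positivity)]; simp
  rw [qCosTransform_latticeStep hq, add_comm n k]
  linear_combination (normQ q * cosQ q (q ^ (2 * (k + n))) * sinQ q (q ^ (2 * (k + M)))) * hk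

lemma qCosTransform_qCosTransform (hq : 1 < q) (M n : ℤ) :
    qCosTransform q (qCosTransform q (latticeStep M)) n =
      normQ q ^ 2 * ∑' k : ℤ, cosQ q (q ^ (2 * (k + n))) * sinQ q (q ^ (2 * (k + M))) := by
  rw [qCosTransform, tsum_congr (inverse_term_eq hq M n), tsum_mul_left, ← mul_assoc, sq]

/-- The `q`-cosine transform inverts itself on the lattice step function. -/
lemma qCosTransform_qCosTransform_latticeStep (hq : 1 < q) (M n : ℤ) :
    qCosTransform q (qCosTransform q (latticeStep M)) n = latticeStep M n := by
  rw [qCosTransform_qCosTransform hq, tsum_cosQ_mul_sinQ hq]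

lemma hasSum_bessel (hq : 1 < q) (M n : ℤ) :
    HasSum (fun k : ℤ => q ^ (-2 * k) *
        besselJ (q ^ (-4 : ℤ)) (-1 / 2) (q ^ (2 * (n - k))) *
        besselJ (q ^ (-4 : ℤ)) (1 / 2) (q ^ (2 * (M - k))))
      (q ^ (-(M + n)) * (normQ q ^ 2 *
        ∑' k : ℤ, cosQ q (q ^ (2 * (k + n))) * sinQ q (q ^ (2 * (k + M))))) := by
  have hq0 : q ≠ 0 := by positivity
  have h := ((Equiv.neg ℤ).hasSum_iff.2 (summable_cosQ_mul_sinQ hq n M).hasSum).mul_left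
    (q ^ (-(M + n)) * normQ q ^ 2)
  rw [mul_assoc] at h
  refine h.congr_fun fun k => ?_
  have e : q ^ (-2 * k) * q ^ (-(n - k)) * q ^ (-(M - k)) = q ^ (-(M + n)) := by
    rw [← zpow_add₀ hq0, ← zpow_add₀ hq0]; congr 1; ring
  rw [besselJ_neg_half hq, besselJ_half hq, ← e]
  simp only [Function.comp_apply, Equiv.neg_apply, neg_add_eq_sub]
  ring

/-! ### The hypergeometric series -/

/-- Absolute convergence of `₂Φ₁` for `|z| < 1` by the ratio test. No condition on `c` is needed: if
some `(c; b)_n` vanishes, the later terms are zero by the convention for division. -/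
lemma summable_phi21Term (a₁ a₂ : ℝ) {c b z : ℝ} (hb0 : 0 < b) (hb1 : b < 1) (hz : |z| < 1) :
    Summable (phi21Term a₁ a₂ c b z) := by
  obtain ⟨r, hr1, hr2⟩ := exists_between hz
  refine summable_of_ratio_norm_eventually_le hr2 ?_
  have hl : ∀ a : ℝ, Tendsto (fun n : ℕ => 1 - a * b ^ n) atTop (𝓝 1) := fun a => by
    simpa using ((tendsto_pow_atTop_nhds_zero_of_lt_one hb0.le hb1).const_mul a).const_sub 1
  have ht : Tendsto (fun n : ℕ =>
      |(1 - a₁ * b ^ n) * (1 - a₂ * b ^ n) / ((1 - c * b ^ n) * (1 - b * b ^ n)) * z|) atTop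
      (𝓝 |z|) := by
    simpa using ((((hl a₁).mul (hl a₂)).div ((hl c).mul (hl b)) (by simp)).mul_const z).abs
  filter_upwards [ht.eventually_le_const hr1] with n hn
  have e : phi21Term a₁ a₂ c b z (n + 1) =
      (1 - a₁ * b ^ n) * (1 - a₂ * b ^ n) / ((1 - c * b ^ n) * (1 - b * b ^ n)) * z *
        phi21Term a₁ a₂ c b z n := by
    simp only [phi21Term, qPoch_succ, pow_succ, div_eq_mul_inv, mul_inv]
    ring
  rw [e, norm_mul, Real.norm_eq_abs]
  exact mul_le_mul_of_nonneg_right hn (norm_nonneg _)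

/-- A numerator parameter `1` reduces `₂Φ₁` to its constant term. -/
lemma phi21_one_left (a₂ c b z : ℝ) : phi21 1 a₂ c b z = 1 := by
  rw [phi21, tsum_eq_single 0]
  · simp [phi21Term, qPoch]
  · intro n hn
    obtain ⟨m, rfl⟩ := Nat.exists_eq_succ_of_ne_zero hn
    have : qPoch 1 b (m + 1) = 0 := by
      rw [qPoch, Finset.prod_range_succ']
      simp
    simp [phi21Term, this]

end

theorem mainTheorem12 (q : ℝ) (hq : 1 < q) (M : ℤ) :
    -- the `q`-cosine transform of the step function
    (∀ k : ℤ,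
      Summable (fun n : ℤ => q ^ (2 * n) * cosQ q (q ^ (2 * (k + n))) * latticeStep M n) ∧
      qCosTransform q (latticeStep M) k =
        normQ q * ∑' n : Set.Iic M, q ^ (2 * (n : ℤ)) * cosQ q (q ^ (2 * (k + (n : ℤ)))) ∧
      qCosTransform q (latticeStep M) k =
        normQ q * q ^ (-2 * k) * qIntegral q (qDeriv q (fun x => sinQ q (x * q ^ (2 * k)))) M ∧
      qIntegral q (qDeriv q (fun x => sinQ q (x * q ^ (2 * k)))) M =
        sinQ q (q ^ (2 * (k + M))) ∧
      qCosTransform q (latticeStep M) k =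
        normQ q * q ^ (-2 * k) * sinQ q (q ^ (2 * (k + M)))) ∧
    -- the inverse transform
    (∀ n : ℤ,
      Summable (fun k : ℤ =>
        q ^ (2 * k) * cosQ q (q ^ (2 * (n + k))) * qCosTransform q (latticeStep M) k) ∧
      qCosTransform q (qCosTransform q (latticeStep M)) n =
        normQ q ^ 2 * ∑' k : ℤ, cosQ q (q ^ (2 * (k + n))) * sinQ q (q ^ (2 * (k + M))) ∧
      -- expression through `q`-Bessel functions of base `q^{-4}`
      Summable (fun k : ℤ => q ^ (-2 * k) *
        besselJ (q ^ (-4 : ℤ)) (-1 / 2) (q ^ (2 * (n - k))) *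
        besselJ (q ^ (-4 : ℤ)) (1 / 2) (q ^ (2 * (M - k)))) ∧
      qCosTransform q (qCosTransform q (latticeStep M)) n =
        q ^ (M + n) * ∑' k : ℤ, q ^ (-2 * k) *
          besselJ (q ^ (-4 : ℤ)) (-1 / 2) (q ^ (2 * (n - k))) *
          besselJ (q ^ (-4 : ℤ)) (1 / 2) (q ^ (2 * (M - k))) ∧
      -- evaluation through basic hypergeometric series
      (M < n →
        Summable (phi21Term (q ^ (-4 : ℤ)) (q ^ (-2 : ℤ)) (q ^ (-6 : ℤ)) (q ^ (-4 : ℤ))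
          (q ^ (-4 * (n - M)))) ∧
        qCosTransform q (qCosTransform q (latticeStep M)) n =
          q ^ (M + n) * (q ^ (M - 3 * n) *
            (qPochInf 1 (q ^ (-4 : ℤ)) * qPochInf (q ^ (-6 : ℤ)) (q ^ (-4 : ℤ)) /
              (qPochInf (q ^ (-2 : ℤ)) (q ^ (-4 : ℤ)) *
                qPochInf (q ^ (-4 : ℤ)) (q ^ (-4 : ℤ)))) *
            phi21 (q ^ (-4 : ℤ)) (q ^ (-2 : ℤ)) (q ^ (-6 : ℤ)) (q ^ (-4 : ℤ))
              (q ^ (-4 * (n - M))))) ∧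
      (n ≤ M →
        Summable (phi21Term 1 (q ^ (-2 : ℤ)) (q ^ (-2 : ℤ)) (q ^ (-4 : ℤ))
          (q ^ (-4 * (M - n + 1)))) ∧
        qCosTransform q (qCosTransform q (latticeStep M)) n =
          q ^ (M + n) * (q ^ (-(M + n)) *
            (qPochInf (q ^ (-4 : ℤ)) (q ^ (-4 : ℤ)) * qPochInf (q ^ (-2 : ℤ)) (q ^ (-4 : ℤ)) /
              (qPochInf (q ^ (-2 : ℤ)) (q ^ (-4 : ℤ)) *
                qPochInf (q ^ (-4 : ℤ)) (q ^ (-4 : ℤ)))) *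
            phi21 1 (q ^ (-2 : ℤ)) (q ^ (-2 : ℤ)) (q ^ (-4 : ℤ))
              (q ^ (-4 * (M - n + 1))))) ∧
      -- recovery of the step function
      (M < n → qCosTransform q (qCosTransform q (latticeStep M)) n = 0) ∧
      (n ≤ M → qCosTransform q (qCosTransform q (latticeStep M)) n = 1) ∧
      qCosTransform q (qCosTransform q (latticeStep M)) n = latticeStep M n) ∧
    qPochInf 1 (q ^ (-4 : ℤ)) = 0 := by
  have hq0 : q ≠ 0 := by positivity
  have hp0 := zpow_neg_two_pos hq
  have hp1 := zpow_neg_two_lt_one hq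
  have hb0 : 0 < q ^ (-4 : ℤ) := by positivity
  have hlt : ∀ i : ℤ, i < 0 → q ^ i < 1 := fun i hi => zpow_lt_one_of_neg₀ hq hi
  have hb1 := hlt (-4) (by norm_num)
  have hb : |q ^ (-4 : ℤ)| < 1 := by rwa [abs_of_pos hb0]
  have habs : ∀ i : ℤ, i < 0 → |q ^ i| < 1 := fun i hi => by
    rw [abs_of_pos (by positivity)]; exact hlt i hi
  refine ⟨fun k => ⟨(hasSum_mul_latticeStep hq k M).summable, ?_, ?_, qIntegral_qDeriv_sinQ hq k M,
    qCosTransform_latticeStep hq k M⟩, fun n => ⟨?_, qCosTransform_qCosTransform hq M n,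
    (hasSum_bessel hq M n).summable, ?_, fun hn => ⟨?_, ?_⟩, fun hn => ⟨?_, ?_⟩, fun hn => ?_,
    fun hn => ?_, qCosTransform_qCosTransform_latticeStep hq M n⟩, qPochInf_one hb⟩
  · rw [qCosTransform_latticeStep hq, (hasSum_Iic_zpow_mul_cosQ hq k M).tsum_eq, mul_assoc]
  · rw [qCosTransform_latticeStep hq, qIntegral_qDeriv_sinQ hq]
  · exact ((summable_cosQ_mul_sinQ hq n M).mul_left (normQ q)).congr fun k =>
      (inverse_term_eq hq M n k).symm
  · rw [(hasSum_bessel hq M n).tsum_eq, qCosTransform_qCosTransform hq, ← mul_assoc,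
      ← zpow_add₀ hq0, add_neg_cancel, zpow_zero, one_mul]
  · exact summable_phi21Term _ _ hb0 hb1 (habs _ (by omega))
  · rw [qCosTransform_qCosTransform_latticeStep hq, qPochInf_one hb, latticeStep,
      if_neg (not_le.2 hn)]
    simp
  · exact summable_phi21Term _ _ hb0 hb1 (habs _ (by omega))
  · rw [qCosTransform_qCosTransform_latticeStep hq, phi21_one_left, latticeStep, if_pos hn,
      mul_comm (qPochInf (q ^ (-4 : ℤ)) _), div_self (mul_ne_zero
        (qPochInf_ne_zero hb0 hb1 (habs _ (by norm_num))) (qPochInf_ne_zero hb0 hb1 hb)),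
      mul_one, mul_one, ← zpow_add₀ hq0, add_neg_cancel, zpow_zero]
  · rw [qCosTransform_qCosTransform_latticeStep hq, latticeStep, if_neg (not_le.2 hn)]
  · rw [qCosTransform_qCosTransform_latticeStep hq, latticeStep, if_pos hn]
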